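/- A tree is a partially ordered set $(T,<)$ in which the set of predecessors of every node is well-ordered by $<$. The height of a node is the order type of its set of predecessors, the $\beta$-th level of $T$ is the set of nodes of height $\beta$, and the height of $T$ is $\sup\{\mathrm{height}(x)+1 : x\in T\}$. A tree is normal if all its levels are countable, every non-maximal node has at least two immediate successors, every node has an extension on each higher level of $T$, and nodes on a limit level with the same predecessors are equal. (A unique root is not required.) A Suslin tree is a normal tree of height $\omega_1$ without uncountable antichains (sets of pairwise incomparable nodes). The tree product $T_0\times\dots\times T_n$ consists of the tuples $(t_0,\dots,t_n)$ with $t_i\in T_i$ and all $t_i$ of the same height, ordered by $(t_i)_i<(s_i)_i$ if and only if $t_i<s_i$ for all $i$. A family $(T_\alpha : \alpha\in I)$ of Suslin trees is independent if for every finite nonempty set $\{e_0,\dots,e_n\}\subset I$ of (pairwise distinct) indices $T_{e_0}\times\dots\times T_{e_n}$ is a Suslin tree. For a tree $T$, the tree forcing, also denoted by $T$, has the nodes of $T$ as conditions, a higher node being stronger. Baumgartner's specializing forcing $Sp(T)$ consists of the finite partial functions $p$ from $T$ to $\omega$ with $p(x)\neq p(y)$ whenever $x<y$ are in the domain of $p$,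 ordered by reverse inclusion. Lemma. Let $(T_\alpha : \alpha\in I)$ be an independent family of Suslin trees, indexed by an arbitrary set $I$ (for instance by an ordinal $\eta$), and let $f:I\to 2$ be an arbitrary function. For $\alpha\in I$ let $$\mathbb{P}_\alpha=\begin{cases}T_\alpha & \text{if } f(\alpha)=1,\\ Sp(T_\alpha) & \text{if } f(\alpha)=0.\end{cases}$$ Then the finite support product $\mathbb{D}(f)=\prod_{\alpha\in I}\mathbb{P}_\alpha$ has the countable chain condition: every set of pairwise incompatible conditions is countable. Here the conditions of $\mathbb{D}(f)$ are the functions on $I$ that take a value in $\mathbb{P}_\alpha$ at finitely many coordinates $\alpha$ and the trivial (adjoined largest) condition at all others, ordered coordinatewise. -/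

import Mathlib

universe u v

open Order

/-! ### Set-theoretic trees -/

/-- A (set-theoretic) tree: a partial order in which the predecessors of every node are
well-ordered by `<`. -/
class IsSetTree (T : Type u) [PartialOrder T] : Prop where
  isWellOrder_Iio : ∀ x : T, IsWellOrder (Set.Iio x) (· < ·)

/-- The height of a node: the order type of its set of predecessors. -/
noncomputable def nodeHeight {T : Type u} [PartialOrder T] [IsSetTree T] (x : T) :
    Ordinal.{u} :=
  @Ordinal.type (Set.Iio x) (· < ·) (IsSetTree.isWellOrder_Iio x)

/-- The height of a tree: the supremum of `nodeHeight x + 1` over all nodes `x`. -/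
noncomputable def treeHeight (T : Type u) [PartialOrder T] [IsSetTree T] : Ordinal.{u} :=
  ⨆ x : T, succ (nodeHeight x)

/-- Normal trees. A unique root is not demanded. -/
structure IsNormalTree (T : Type u) [PartialOrder T] [IsSetTree T] : Prop where
  /-- all levels are countable -/
  countable_level : ∀ β : Ordinal.{u}, {x : T | nodeHeight x = β}.Countable
  /-- every nonmaximal node has at least two immediate successors -/
  splitting : ∀ x : T, ¬ IsMax x → ∃ y z : T, y ≠ z ∧ x ⋖ y ∧ x ⋖ z
  /-- every node has extensions on all higher levels of the tree -/
  extension : ∀ (x : T) (β : Ordinal.{u}), nodeHeight x < β → β < treeHeight T →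
    ∃ y : T, x < y ∧ nodeHeight y = β
  /-- nodes on a limit level are determined by their predecessors -/
  limit_unique : ∀ x y : T, IsSuccLimit (nodeHeight x) → Set.Iio x = Set.Iio y → x = y

/-- A Suslin tree: a normal tree of height `ω₁` without uncountable antichains. -/
structure IsSuslinTree (T : Type u) [PartialOrder T] [IsSetTree T] : Prop where
  normal : IsNormalTree T
  height_eq : treeHeight T = Ordinal.omega 1
  countable_antichain : ∀ A : Set T, IsAntichain (· ≤ ·) A → A.Countable

/-! ### The height function is strictly monotone -/

theorem nodeHeight_lt {T : Type u} [PartialOrder T] [IsSetTree T] {x y : T} (h : x < y) :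
    nodeHeight x < nodeHeight y := by
  have := IsSetTree.isWellOrder_Iio x
  have := IsSetTree.isWellOrder_Iio y
  refine Ordinal.type_lt_iff.2 ⟨⟨⟨⟨fun z => ⟨z.1, lt_trans z.2 h⟩, ?_⟩, ?_⟩, ⟨x, h⟩, ?_⟩⟩
  · intro a b hab
    exact Subtype.ext (congrArg (fun w : Set.Iio y => w.1) hab)
  · intro a b
    exact Iff.rfl
  · intro b
    constructor
    · rintro ⟨a, rfl⟩
      exact a.2
    · intro hb
      exact ⟨⟨b.1, hb⟩, rfl⟩

/-- Two predecessors of a common node compare as their heights do. -/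
theorem lt_of_nodeHeight_lt {T : Type u} [PartialOrder T] [IsSetTree T] {x y z : T}
    (hx : x < z) (hy : y < z) (h : nodeHeight x < nodeHeight y) : x < y := by
  have := IsSetTree.isWellOrder_Iio z
  rcases trichotomous_of (· < ·) (⟨x, hx⟩ : Set.Iio z) ⟨y, hy⟩ with h1 | h1 | h1
  · exact h1
  · have : x = y := congrArg Subtype.val h1
    subst this
    exact absurd h (lt_irrefl _)
  · exact absurd (h.trans (nodeHeight_lt (show y < x from h1))) (lt_irrefl _)

theorem eq_of_nodeHeight_eq {T : Type u} [PartialOrder T] [IsSetTree T] {x y z : T}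
    (hx : x < z) (hy : y < z) (h : nodeHeight x = nodeHeight y) : x = y := by
  have := IsSetTree.isWellOrder_Iio z
  rcases trichotomous_of (· < ·) (⟨x, hx⟩ : Set.Iio z) ⟨y, hy⟩ with h1 | h1 | h1
  · exact absurd h (nodeHeight_lt (show x < y from h1)).ne
  · exact congrArg Subtype.val h1
  · exact absurd h (nodeHeight_lt (show y < x from h1)).ne'

/-! ### Tree products -/

/-- The tree product of a family of trees: tuples of nodes, all of the same height. -/
def TreeProduct {κ : Type u} (T : κ → Type v) [∀ i, PartialOrder (T i)]
    [∀ i, IsSetTree (T i)] : Type (max u v) :=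
  {t : ∀ i, T i // ∀ i j, nodeHeight (t i) = nodeHeight (t j)}

namespace TreeProduct

variable {κ : Type u} {T : κ → Type v} [∀ i, PartialOrder (T i)] [∀ i, IsSetTree (T i)]

/-- The tree product is ordered by `t < s` iff `t i < s i` for all `i`
(see `TreeProduct.lt_iff`). -/
instance : PartialOrder (TreeProduct T) where
  le t s := t = s ∨ ∀ i, t.1 i < s.1 i
  le_refl t := Or.inl rfl
  le_trans r s t := by
    rintro (rfl | h1) (rfl | h2)
    · exact Or.inl rfl
    · exact Or.inr h2
    · exact Or.inr h1
    · exact Or.inr fun i => (h1 i).trans (h2 i)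
  le_antisymm s t := by
    rintro (rfl | h1) (h | h2)
    · rfl
    · rfl
    · exact h.symm
    · exact Subtype.ext (funext fun i => absurd (h1 i) (h2 i).asymm)

theorem lt_iff [Nonempty κ] (t s : TreeProduct T) : t < s ↔ ∀ i, t.1 i < s.1 i := by
  constructor
  · rintro ⟨rfl | h, h'⟩
    · exact absurd (Or.inl rfl) h'
    · exact h
  · intro h
    refine ⟨Or.inr h, ?_⟩
    obtain ⟨i⟩ := ‹Nonempty κ›
    rintro (rfl | h')
    · exact lt_irrefl _ (h i)
    · exact (h i).asymm (h' i)

instance : IsSetTree (TreeProduct T) where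
  isWellOrder_Iio t := by
    rcases isEmpty_or_nonempty κ with hκ | hκ
    · have : IsEmpty (Set.Iio t) :=
        ⟨fun s => (show s.1 < t from s.2).ne (Subtype.ext (funext fun i => hκ.elim i))⟩
      infer_instance
    · obtain ⟨i⟩ := id hκ
      have := IsSetTree.isWellOrder_Iio (t.1 i)
      have hwf : WellFounded (fun a b : Set.Iio t => a < b) := by
        let g : Set.Iio t → Set.Iio (t.1 i) := fun s => ⟨s.1.1 i, (lt_iff _ _).1 s.2 i⟩
        have hw : WellFounded (fun a b : Set.Iio (t.1 i) => a < b) := IsWellFounded.wf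
        refine Subrelation.wf ?_ (InvImage.wf g hw)
        intro a b hab
        exact (lt_iff a.1 b.1).1 hab i
      have htri : ∀ a b : Set.Iio t, a < b ∨ a = b ∨ b < a := by
        intro a b
        have ha := (lt_iff _ _).1 a.2
        have hb := (lt_iff _ _).1 b.2
        rcases lt_trichotomy (nodeHeight (a.1.1 i)) (nodeHeight (b.1.1 i)) with h | h | h
        · refine Or.inl ((lt_iff a.1 b.1).2 fun j => lt_of_nodeHeight_lt (ha j) (hb j) ?_)
          rwa [a.1.2 j i, b.1.2 j i]
        · refine Or.inr (Or.inl (Subtype.ext (Subtype.ext (funext fun j =>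
            eq_of_nodeHeight_eq (ha j) (hb j) ?_))))
          rwa [a.1.2 j i, b.1.2 j i]
        · refine Or.inr (Or.inr ((lt_iff b.1 a.1).2 fun j =>
            lt_of_nodeHeight_lt (hb j) (ha j) ?_))
          rwa [a.1.2 j i, b.1.2 j i]
      exact { wf := hwf, trichotomous := fun a b h1 h2 => by
                rcases htri a b with h | h | h
                · exact absurd h h1
                · exact h
                · exact absurd h h2 }

end TreeProduct

/-- An independent family of Suslin trees: the tree product of any finitely many (and at least
one) members of the family with pairwise distinct indices is a Suslin tree. -/
def IsIndependentSuslinFamily {ι : Type u} (T : ι → Type v) [∀ α, PartialOrder (T α)]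
    [∀ α, IsSetTree (T α)] : Prop :=
  (∀ α, IsSuslinTree (T α)) ∧
    ∀ e : Finset ι, e.Nonempty → IsSuslinTree (TreeProduct fun α : e => T α)

/-! ### Forcing notions

Forcing notions are preorders in which `p ≤ q` means that `p` is stronger than `q`. -/

/-- Two conditions are compatible if they have a common extension. -/
def ForcingCompatible {P : Type u} [Preorder P] (p q : P) : Prop :=
  ∃ r : P, r ≤ p ∧ r ≤ q

/-- The countable chain condition: every set of pairwise incompatible conditions is countable. -/
def CountableChainCondition (P : Type u) [Preorder P] : Prop :=
  ∀ A : Set P, (A.Pairwise fun p q => ¬ ForcingCompatible p q) → A.Countable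

/-- Baumgartner's forcing specializing `T`. Conditions are finite partial functions `p` from `T`
to `ℕ` (`p x = none` means that `x` is not in the domain of `p`) that do not take the same value
at two comparable distinct nodes of their domain. -/
def SpecializingForcing (T : Type u) [PartialOrder T] : Type u :=
  {p : T → Option ℕ // {x | p x ≠ none}.Finite ∧
    ∀ (x y : T) (m n : ℕ), x < y → p x = some m → p y = some n → m ≠ n}

/-- Specializing conditions are ordered by reverse inclusion. -/
instance (T : Type u) [PartialOrder T] : Preorder (SpecializingForcing T) where
  le p q := ∀ (x : T) (n : ℕ), q.1 x = some n → p.1 x = some n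
  le_refl _ _ _ h := h
  le_trans _ _ _ h1 h2 x n h := h1 x n (h2 x n h)

/-- The forcing used to code one bit into `T`: for the bit `1` the forcing with the tree `T`
itself, whose conditions are the nodes, higher nodes being stronger; for the bit `0` the
specializing forcing. -/
def BitForcing (T : Type u) [PartialOrder T] : Fin 2 → Type u
  | 0 => SpecializingForcing T
  | 1 => Tᵒᵈ

instance (T : Type u) [PartialOrder T] : (b : Fin 2) → Preorder (BitForcing T b)
  | 0 => inferInstanceAs (Preorder (SpecializingForcing T))
  | 1 => inferInstanceAs (Preorder Tᵒᵈ)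

/-- The finite support product of a family of forcing notions: a largest (trivial) condition `⊤`
is adjoined to every factor, conditions are the elements of the full product that are `⊤` at all
but finitely many coordinates, and the order is coordinatewise. -/
def FiniteSupportProduct {ι : Type u} (P : ι → Type v) : Type (max u v) :=
  {p : ∀ α, WithTop (P α) // {α | p α ≠ ⊤}.Finite}

instance {ι : Type u} (P : ι → Type v) [∀ α, Preorder (P α)] :
    Preorder (FiniteSupportProduct P) where
  le p q := ∀ α, p.1 α ≤ q.1 α
  le_refl _ _ := le_rfl
  le_trans _ _ _ h1 h2 α := (h1 α).trans (h2 α)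

/-! ### Chain conditions -/

/-! Start from an uncountable set of pairwise incompatible conditions. Thin it out so that the
supports, and the graphs of the specializing parts, are lists of fixed length in which each entry is
constant or injective; this plays the role of a Δ-system. Let `e` be a finite set of coordinates
with `f α = 1` that contains all those common to the supports.

By independence the product of the `T α` with `α ∈ e` is ccc, and so is its product with any `T b`,
`b ∉ e`; in effect `T b` stays Suslin after forcing with the trees in `e`. In that extension
uncountably many of the given conditions have their tree parts in the generic filter. In a Suslin
tree, two uncountable injective families of nodes shrink to uncountable families without
comparabilities between them (`ForcesUncountable.exists_incomparable`). Doing this for all pairs of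
entries leaves `p ≠ q` with compatible tree parts such that, of any two comparable specialized
nodes, one from each, at least one is a constant entry and hence shared. Then `p` and `q` are
compatible.

No extension is constructed: `ForcesUncountable` expresses uncountability in it combinatorially, and
`ForcingSeparable` makes the successive thinnings composable. -/

theorem Set.nonempty_of_not_countable {α : Type*} {s : Set α} (h : ¬ s.Countable) :
    s.Nonempty := by
  by_contra hn
  exact h (Set.not_nonempty_iff_eq_empty.1 hn ▸ Set.countable_empty)

theorem ForcingCompatible.refl {P : Type*} [Preorder P] (p : P) : ForcingCompatible p p :=
  ⟨p, le_rfl, le_rfl⟩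

/-- The countable chain condition pulls back along maps that reflect compatibility. -/
theorem CountableChainCondition.of_map {P : Type*} {Q : Type*} [Preorder P] [Preorder Q]
    (hQ : CountableChainCondition Q) (g : P → Q)
    (hg : ∀ a b, ForcingCompatible (g a) (g b) → ForcingCompatible a b) :
    CountableChainCondition P := by
  intro A hA
  have hinj : Set.InjOn g A := by
    intro a ha b hb hab
    by_contra hne
    exact hA ha hb hne (hg a b (hab ▸ ForcingCompatible.refl _))
  refine Set.countable_of_injective_of_countable_image hinj (hQ _ ?_)
  rintro _ ⟨a, ha, rfl⟩ _ ⟨b, hb, rfl⟩ hne hc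
  exact hA ha hb (fun h => hne (h ▸ rfl)) (hg a b hc)

/-- `u` forces that uncountably many `ξ ∈ X` have `r ξ` in the generic filter: every extension
of `u` is compatible with `r ξ` for uncountably many `ξ ∈ X`. -/
def ForcesUncountable {I P : Type*} [Preorder P] (r : I → P) (u : P) (X : Set I) : Prop :=
  ∀ u' ≤ u, ¬ {ξ ∈ X | ForcingCompatible (r ξ) u'}.Countable

namespace ForcesUncountable

variable {I P : Type*} [Preorder P] {r : I → P} {u v : P} {X : Set I}

theorem mono_left (h : ForcesUncountable r u X) (hv : v ≤ u) : ForcesUncountable r v X :=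
  fun u' hu' => h u' (hu'.trans hv)

theorem diff_countable (h : ForcesUncountable r u X) {C : Set I} (hC : C.Countable) :
    ForcesUncountable r u (X \ C) := by
  intro u' hu' hc
  refine h u' hu' ((hc.union hC).mono ?_)
  rintro ξ ⟨hξ, hξ'⟩
  by_cases hm : ξ ∈ C
  · exact Or.inr hm
  · exact Or.inl ⟨⟨hξ, hm⟩, hξ'⟩

end ForcesUncountable

/-- In a ccc forcing, some condition forces that the generic filter contains uncountably many
members of a given uncountable family. -/
theorem CountableChainCondition.exists_forcesUncountable {I P : Type*} [Preorder P]
    (hP : CountableChainCondition P) (r : I → P) {X : Set I} (hX : ¬ X.Countable) :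
    ∃ u, ForcesUncountable r u X := by
  by_contra! hcon
  have hdense : ∀ u : P, ∃ u' ≤ u, {ξ ∈ X | ForcingCompatible (r ξ) u'}.Countable := by
    intro u
    have := hcon u
    unfold ForcesUncountable at this
    push Not at this
    exact this
  -- A maximal antichain of conditions compatible with only countably many `r ξ`. It is countable,
  -- so some `r ξ` is incompatible with all of it, and density below `r ξ` contradicts maximality.
  obtain ⟨M, hM⟩ := zorn_subset
    {M : Set P | (M.Pairwise fun p q => ¬ ForcingCompatible p q) ∧
      ∀ m ∈ M, {ξ ∈ X | ForcingCompatible (r ξ) m}.Countable} (by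
    intro c hc hchain
    refine ⟨⋃₀ c, ⟨?_, ?_⟩, fun s hs => Set.subset_sUnion_of_mem hs⟩
    · exact (Set.pairwise_sUnion hchain.directedOn).2 fun s hs => (hc hs).1
    · rintro m ⟨s, hs, hm⟩
      exact (hc hs).2 m hm)
  have hcount : (⋃ m ∈ M, {ξ ∈ X | ForcingCompatible (r ξ) m}).Countable :=
    (hP M hM.prop.1).biUnion hM.prop.2
  obtain ⟨ξ, hξX, hξ⟩ : ∃ ξ ∈ X, ξ ∉ ⋃ m ∈ M, {ξ ∈ X | ForcingCompatible (r ξ) m} := by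
    by_contra! h
    exact hX (hcount.mono h)
  simp only [Set.mem_iUnion, Set.mem_ofPred_eq, not_exists, not_and] at hξ
  obtain ⟨u', hu', hu'c⟩ := hdense (r ξ)
  have hinc : ∀ m ∈ M, ¬ ForcingCompatible u' m := by
    rintro m hm ⟨w, hw1, hw2⟩
    exact hξ m hm hξX ⟨w, hw1.trans hu', hw2⟩
  have hins : insert u' M ⊆ M := by
    refine hM.le_of_ge ⟨?_, ?_⟩ (Set.subset_insert _ _)
    · refine hM.prop.1.insert fun m hm _ => ⟨hinc m hm, ?_⟩
      rintro ⟨w, hw1, hw2⟩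
      exact hinc m hm ⟨w, hw2, hw1⟩
    · rintro m (rfl | hm)
      · exact hu'c
      · exact hM.prop.2 m hm
  exact hinc u' (hins (Set.mem_insert _ _)) (ForcingCompatible.refl _)

/-! ### Suslin trees -/

section SetTree

variable {T : Type*} [PartialOrder T] [IsSetTree T]

theorem IsSetTree.le_total_of_le {x y z : T} (hx : x ≤ z) (hy : y ≤ z) : x ≤ y ∨ y ≤ x := by
  rcases hx.eq_or_lt with rfl | hx
  · exact Or.inr hy
  rcases hy.eq_or_lt with rfl | hy
  · exact Or.inl hx.le
  have := IsSetTree.isWellOrder_Iio z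
  rcases trichotomous_of (· < ·) (⟨x, hx⟩ : Set.Iio z) ⟨y, hy⟩ with h | h | h
  · exact Or.inl (le_of_lt h)
  · exact Or.inl (congrArg Subtype.val h).le
  · exact Or.inr (le_of_lt h)

theorem nodeHeight_lt_treeHeight (x : T) : nodeHeight x < treeHeight T :=
  (lt_succ _).trans_le (Ordinal.le_iSup (fun y : T => succ (nodeHeight y)) x)

/-- Allows the part of an uncountable family lying below a given node to be discarded. -/
theorem IsSuslinTree.countable_Iic (hT : IsSuslinTree T) (x : T) : (Set.Iic x).Countable := by
  have h : (Set.Iio x).Countable := by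
    have h1 := nodeHeight_lt_treeHeight x
    rw [hT.height_eq] at h1
    have := IsSetTree.isWellOrder_Iio x
    have h2 := Cardinal.lt_ord.1 (h1.trans_eq (Cardinal.ord_aleph 1).symm)
    rw [nodeHeight, Ordinal.card_type] at h2
    rw [← Set.countable_coe_iff, ← Cardinal.mk_le_aleph0_iff]
    rwa [← Order.lt_succ_iff, Cardinal.succ_aleph0]
  rw [← Set.Iio_insert]
  exact h.insert x

theorem IsSuslinTree.nonempty (hT : IsSuslinTree T) : Nonempty T := by
  by_contra h
  rw [not_nonempty_iff] at h
  have h1 := hT.height_eq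
  rw [treeHeight, ciSup_of_empty] at h1
  exact absurd h1 (Ordinal.omega_pos 1).ne

theorem IsSuslinTree.exists_le_nodeHeight_eq (hT : IsSuslinTree T) (x : T) {β : Ordinal}
    (h : nodeHeight x ≤ β) (hβ : β < Ordinal.omega 1) : ∃ y, x ≤ y ∧ nodeHeight y = β := by
  rcases h.eq_or_lt with rfl | h
  · exact ⟨x, le_rfl, rfl⟩
  · obtain ⟨y, hy, hy'⟩ := hT.normal.extension x β h (hT.height_eq ▸ hβ)
    exact ⟨y, hy.le, hy'⟩

theorem IsSuslinTree.countableChainCondition (hT : IsSuslinTree T) :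
    CountableChainCondition Tᵒᵈ := by
  intro A hA
  refine Set.countable_of_injective_of_countable_image OrderDual.ofDual.injective.injOn
    (hT.countable_antichain _ ?_)
  rintro _ ⟨a, ha, rfl⟩ _ ⟨b, hb, rfl⟩ hne hle
  exact hA ha hb (fun h => hne (h ▸ rfl)) ⟨b, hle, le_rfl⟩

/-- If `T` remains Suslin after forcing with `P`, then every uncountable subset of `T` that `P`
adds has uncountably many elements above each of two incomparable nodes. -/
theorem ForcesUncountable.exists_split (hT : IsSuslinTree T) {I P : Type*} [Preorder P]
    (hP : CountableChainCondition (P × Tᵒᵈ)) {r : I → P} {u : P} {X : Set I}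
    (hX : ForcesUncountable r u X) {x : I → T} (hx : Set.InjOn x X) :
    ∃ u' ≤ u, ∃ s s' : T, ¬ s ≤ s' ∧ ¬ s' ≤ s ∧ ForcesUncountable r u' {ξ ∈ X | s < x ξ} ∧
      ForcesUncountable r u' {ξ ∈ X | s' < x ξ} := by
  have hw : ∀ ξ, ∃ w : P, ForcingCompatible (r ξ) u → w ≤ r ξ ∧ w ≤ u := by
    intro ξ
    by_cases h : ForcingCompatible (r ξ) u
    · obtain ⟨w, hw⟩ := h
      exact ⟨w, fun _ => hw⟩
    · exact ⟨u, fun h' => absurd h' h⟩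
  choose w hw using hw
  -- This is where the ccc of `P × Tᵒᵈ` enters: `(q, s)` forces uncountably many `(w ξ, x ξ)` into
  -- the generic filter, so the family is uncountable above every node extending `s`.
  obtain ⟨⟨q, s⟩, hqs⟩ := hP.exists_forcesUncountable
    (fun ξ => (w ξ, OrderDual.toDual (x ξ))) (hX u le_rfl)
  obtain ⟨ξ, hξ, ⟨q₁, _⟩, hq₁⟩ := Set.nonempty_of_not_countable (hqs _ le_rfl)
  rw [Prod.mk_le_mk, Prod.mk_le_mk] at hq₁
  have hq₁u : q₁ ≤ u := hq₁.1.1.trans (hw ξ hξ.2).2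
  have key : ∀ s' : T, OrderDual.ofDual s ≤ s' → ForcesUncountable r q₁ {ξ ∈ X | s' < x ξ} := by
    intro s' hs' q' hq' hc
    have hle : {ξ ∈ X | x ξ ≤ s'}.Countable :=
      Set.MapsTo.countable_of_injOn (f := x) (t := Set.Iic s') (fun ξ hξ => hξ.2)
        (hx.mono fun ξ hξ => hξ.1) (hT.countable_Iic s')
    refine hqs (q', OrderDual.toDual s') ⟨hq'.trans hq₁.2.1, hs'⟩ ((hc.union hle).mono ?_)
    rintro ζ ⟨⟨hζX, hζu⟩, ⟨w', z⟩, hz⟩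
    rw [Prod.mk_le_mk, Prod.mk_le_mk] at hz
    obtain ⟨⟨h1, h2⟩, h3, h4⟩ := hz
    by_cases h : x ζ ≤ s'
    · exact Or.inr ⟨hζX, h⟩
    · have h5 : s' ≤ x ζ := (IsSetTree.le_total_of_le
        (z := OrderDual.ofDual z) h2 h4).resolve_left h
      exact Or.inl ⟨⟨hζX, lt_of_le_not_ge h5 h⟩, w', h1.trans (hw ζ hζu).1, h3⟩
  -- Only needed to see that `s` is not maximal, so that it splits.
  obtain ⟨ζ, ⟨_, hζ⟩, _⟩ := Set.nonempty_of_not_countable (key _ le_rfl q₁ le_rfl)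
  obtain ⟨y, z, hyz, hy, hz⟩ := hT.normal.splitting _ (not_isMax_of_lt hζ)
  exact ⟨q₁, hq₁u, y, z, fun h => hz.2 hy.1 (lt_of_le_of_ne h hyz),
    fun h => hy.2 hz.1 (lt_of_le_of_ne h hyz.symm), key y hy.1.le, key z hz.1.le⟩

/-- If `T` remains Suslin after forcing with `P`, then two uncountable subsets of `T` that `P`
adds have uncountable subsets that are incomparable with each other. -/
theorem ForcesUncountable.exists_incomparable (hT : IsSuslinTree T) {I P : Type*} [Preorder P]
    (hP : CountableChainCondition (P × Tᵒᵈ)) {r : I → P} {u : P} {X Y : Set I}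
    (hX : ForcesUncountable r u X) (hY : ForcesUncountable r u Y) {x y : I → T}
    (hx : Set.InjOn x X) (hy : Set.InjOn y Y) :
    ∃ u' ≤ u, ∃ X' ⊆ X, ∃ Y' ⊆ Y, ForcesUncountable r u' X' ∧ ForcesUncountable r u' Y' ∧
      ∀ ξ ∈ X', ∀ η ∈ Y', ¬ x ξ ≤ y η ∧ ¬ y η ≤ x ξ := by
  obtain ⟨u₁, hu₁, s, s', hs, hs', hX₁, hX₂⟩ := hX.exists_split hT hP hx
  obtain ⟨u₂, hu₂, t, t', ht, ht', hY₁, hY₂⟩ := (hY.mono_left hu₁).exists_split hT hP hy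
  have main : ∀ a b : T, ¬ (a ≤ b ∨ b ≤ a) → ForcesUncountable r u₁ {ξ ∈ X | a < x ξ} →
      ForcesUncountable r u₂ {η ∈ Y | b < y η} →
      ∃ u' ≤ u, ∃ X' ⊆ X, ∃ Y' ⊆ Y, ForcesUncountable r u' X' ∧ ForcesUncountable r u' Y' ∧
        ∀ ξ ∈ X', ∀ η ∈ Y', ¬ x ξ ≤ y η ∧ ¬ y η ≤ x ξ := by
    intro a b hab ha hb
    refine ⟨u₂, hu₂.trans hu₁, _, Set.sep_subset _ _, _, Set.sep_subset _ _,
      ha.mono_left hu₂, hb, ?_⟩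
    rintro ξ ⟨_, hξ⟩ η ⟨_, hη⟩
    exact ⟨fun h => hab (IsSetTree.le_total_of_le (hξ.le.trans h) hη.le),
      fun h => hab (IsSetTree.le_total_of_le hξ.le (hη.le.trans h))⟩
  -- Since `s, s'` and `t, t'` are incomparable pairs, one of `(s, t)`, `(s, t')`, `(s', t)` is
  -- incomparable: if `s` is comparable with both `t` and `t'`, it lies below `t`.
  by_cases h1 : s ≤ t ∨ t ≤ s
  · by_cases h2 : s ≤ t' ∨ t' ≤ s
    · have hst : s ≤ t := by
        rcases h1 with h1 | h1
        · exact h1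
        rcases h2 with h2 | h2
        · exact absurd (h1.trans h2) ht
        · exact ((IsSetTree.le_total_of_le h1 h2).elim ht ht').elim
      refine main s' t ?_ hX₂ hY₁
      rintro (h | h)
      · exact (IsSetTree.le_total_of_le hst h).elim hs hs'
      · exact hs (hst.trans h)
    · exact main s t' h2 hX₁ hY₂
  · exact main s t h1 hX₁ hY₁

end SetTree

/-! ### Separating two families -/

/-- A function is constant on `J` or injective on `J`. -/
def ConstOrInjOn {I X : Type*} (g : I → X) (J : Set I) : Prop :=
  (∃ c, ∀ ξ ∈ J, g ξ = c) ∨ Set.InjOn g J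

/-- A relation on `J` is separable if any two subfamilies of `J` that are forced to be
uncountable can be thinned out so that the relation holds with countably many exceptions. -/
def ForcingSeparable {I P : Type*} [Preorder P] (r : I → P) (J : Set I)
    (Q : I → I → Prop) : Prop :=
  ∀ u X Y, X ⊆ J → Y ⊆ J → ForcesUncountable r u X → ForcesUncountable r u Y →
    ∃ u' ≤ u, ∃ X' ⊆ X, ∃ Y' ⊆ Y, ForcesUncountable r u' X' ∧ ForcesUncountable r u' Y' ∧
      ∀ ξ ∈ X', {η ∈ Y' | ¬ Q ξ η}.Countable

namespace ForcingSeparable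

variable {I P : Type*} [Preorder P] {r : I → P} {J : Set I} {Q Q' : I → I → Prop}

theorem mono (h : ForcingSeparable r J Q) (hQ : ∀ ξ ∈ J, ∀ η ∈ J, Q ξ η → Q' ξ η) :
    ForcingSeparable r J Q' := by
  intro u X Y hXJ hYJ hX hY
  obtain ⟨u', hu', X', hX', Y', hY', h1, h2, h3⟩ := h u X Y hXJ hYJ hX hY
  refine ⟨u', hu', X', hX', Y', hY', h1, h2, fun ξ hξ => (h3 ξ hξ).mono ?_⟩
  rintro η ⟨hη, hn⟩
  exact ⟨hη, fun hq => hn (hQ ξ (hXJ (hX' hξ)) η (hYJ (hY' hη)) hq)⟩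

theorem of_forall (h : ∀ ξ ∈ J, ∀ η ∈ J, Q ξ η) : ForcingSeparable r J Q := by
  intro u X Y hXJ hYJ hX hY
  refine ⟨u, le_rfl, X, subset_rfl, Y, subset_rfl, hX, hY, fun ξ hξ => ?_⟩
  refine Set.countable_empty.mono ?_
  rintro η ⟨hη, hn⟩
  exact hn (h ξ (hXJ hξ) η (hYJ hη))

theorem and (h : ForcingSeparable r J Q) (h' : ForcingSeparable r J Q') :
    ForcingSeparable r J fun ξ η => Q ξ η ∧ Q' ξ η := by
  intro u X Y hXJ hYJ hX hY
  obtain ⟨u₁, hu₁, X₁, hX₁, Y₁, hY₁, h1, h2, h3⟩ := h u X Y hXJ hYJ hX hY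
  obtain ⟨u₂, hu₂, X₂, hX₂, Y₂, hY₂, h4, h5, h6⟩ :=
    h' u₁ X₁ Y₁ (hX₁.trans hXJ) (hY₁.trans hYJ) h1 h2
  refine ⟨u₂, hu₂.trans hu₁, X₂, hX₂.trans hX₁, Y₂, hY₂.trans hY₁, h4, h5, fun ξ hξ => ?_⟩
  refine ((h3 ξ (hX₂ hξ)).union (h6 ξ hξ)).mono ?_
  rintro η ⟨hη, hn⟩
  by_cases hq : Q ξ η
  · exact Or.inr ⟨hη, fun hq' => hn ⟨hq, hq'⟩⟩
  · exact Or.inl ⟨hY₂ hη, hq⟩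

theorem forall_finite {K : Type*} [Finite K] {R : K → I → I → Prop}
    (h : ∀ k, ForcingSeparable r J (R k)) : ForcingSeparable r J fun ξ η => ∀ k, R k ξ η := by
  classical
  have := Fintype.ofFinite K
  suffices hs : ∀ s : Finset K, ForcingSeparable r J fun ξ η => ∀ k ∈ s, R k ξ η from
    (hs Finset.univ).mono fun ξ _ η _ hq k => hq k (Finset.mem_univ k)
  intro s
  induction s using Finset.induction_on with
  | empty => exact of_forall fun ξ _ η _ k hk => absurd hk (Finset.notMem_empty k)
  | insert a s _ ih =>
    refine ((h a).and ih).mono fun ξ _ η _ hq k hk => ?_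
    rcases Finset.mem_insert.1 hk with rfl | hk
    · exact hq.1
    · exact hq.2 k hk

/-- Each `ξ` has at most one bad `η`; this is why `ForcingSeparable` tolerates countably many
exceptions. -/
theorem ne_of_injOn {X : Type*} (g : I → X) {h : I → X} (hh : Set.InjOn h J) :
    ForcingSeparable r J fun ξ η => g ξ ≠ h η := by
  intro u X Y hXJ hYJ hX hY
  refine ⟨u, le_rfl, X, subset_rfl, Y, subset_rfl, hX, hY, fun ξ hξ => ?_⟩
  refine Set.Subsingleton.countable ?_
  rintro η ⟨hη, hn⟩ ζ ⟨hζ, hn'⟩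
  exact hh (hYJ hη) (hYJ hζ) ((not_not.1 hn).symm.trans (not_not.1 hn'))

theorem ne_of_injOn_of_const {X : Type*} {g h : I → X} (hg : Set.InjOn g J) {c : X}
    (hh : ∀ ξ ∈ J, h ξ = c) : ForcingSeparable r J fun ξ η => g ξ ≠ h η := by
  intro u X Y hXJ hYJ hX hY
  have hC : {ξ ∈ J | g ξ = c}.Countable := by
    refine Set.Subsingleton.countable ?_
    rintro η ⟨hη, hn⟩ ζ ⟨hζ, hn'⟩
    exact hg hη hζ (hn.trans hn'.symm)
  refine ⟨u, le_rfl, _, Set.sdiff_subset, Y, subset_rfl, hX.diff_countable hC, hY,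
    fun ξ hξ => Set.countable_empty.mono ?_⟩
  rintro η ⟨hη, hn⟩
  exact hξ.2 ⟨hXJ hξ.1, (not_not.1 hn).trans (hh η (hYJ hη))⟩

theorem eq_imp_const {X : Type*} {g h : I → X} (hg : ConstOrInjOn g J)
    (hh : ConstOrInjOn h J) :
    ForcingSeparable r J fun ξ η => g ξ = h η →
      ∃ c, (∀ ζ ∈ J, g ζ = c) ∧ ∀ ζ ∈ J, h ζ = c := by
  rcases hh with ⟨c, hc⟩ | hh
  · rcases hg with ⟨d, hd⟩ | hg
    · refine of_forall fun ξ hξ η hη heq => ⟨c, fun ζ hζ => ?_, hc⟩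
      rw [hd ζ hζ, ← hd ξ hξ, heq, hc η hη]
    · exact (ne_of_injOn_of_const hg hc).mono fun ξ _ η _ hne heq => absurd heq hne
  · exact (ne_of_injOn g hh).mono fun ξ _ η _ hne heq => absurd heq hne

/-- Choose `ξ` first, with `w` below `r ξ` and the forcing condition. Below `w` the second family is
still uncountable, so some `η` outside the countable exceptional set has `r η` compatible with `w`.
-/
theorem exists_compatible (h : ForcingSeparable r J Q) (hP : CountableChainCondition P)
    (hJ : ¬ J.Countable) : ∃ ξ ∈ J, ∃ η ∈ J, ForcingCompatible (r ξ) (r η) ∧ Q ξ η := by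
  obtain ⟨u, hu⟩ := hP.exists_forcesUncountable r hJ
  obtain ⟨u₁, hu₁, X, hX, Y, hY, h1, h2, h3⟩ := h u J J subset_rfl subset_rfl hu hu
  obtain ⟨ξ, hξ, w, hw1, hw2⟩ := Set.nonempty_of_not_countable (h1 _ le_rfl)
  obtain ⟨η, ⟨hη, z, hz1, hz2⟩, hn⟩ := Set.nonempty_of_not_subset
    (fun h : _ ⊆ {η ∈ Y | ¬ Q ξ η} => h2 _ hw2 ((h3 ξ hξ).mono h))
  refine ⟨ξ, hX hξ, η, hY hη, ⟨z, hz2.trans hw1, hz1⟩, ?_⟩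
  by_contra hq
  exact hn ⟨hη, hq⟩

end ForcingSeparable

/-! ### Thinning out uncountable families -/

section Thinning

variable {I : Type*} {J : Set I}

theorem ConstOrInjOn.mono {X : Type*} {g : I → X} (h : ConstOrInjOn g J) {J' : Set I}
    (hJ : J' ⊆ J) : ConstOrInjOn g J' :=
  h.imp (fun ⟨c, hc⟩ => ⟨c, fun ξ hξ => hc ξ (hJ hξ)⟩) fun h => h.mono hJ

theorem exists_uncountable_constOrInjOn {X : Type*} (g : I → X) (hJ : ¬ J.Countable) :
    ∃ J' ⊆ J, ¬ J'.Countable ∧ ConstOrInjOn g J' := by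
  by_cases h : ∃ c, ¬ {ξ ∈ J | g ξ = c}.Countable
  · obtain ⟨c, hc⟩ := h
    exact ⟨_, Set.sep_subset _ _, hc, Or.inl ⟨c, fun ξ hξ => hξ.2⟩⟩
  · push Not at h
    -- All fibres are countable, so a transversal of them must be uncountable.
    obtain ⟨J', hJ', hbij⟩ := Set.SurjOn.exists_bijOn_subset (Set.surjOn_image g J)
    refine ⟨J', hJ', fun hc => hJ ?_, Or.inr hbij.injOn⟩
    refine (hc.biUnion fun ξ _ => h (g ξ)).mono fun ζ hζ => ?_
    obtain ⟨ξ, hξ, hξζ⟩ := hbij.surjOn (Set.mem_image_of_mem g hζ)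
    exact Set.mem_biUnion hξ ⟨hζ, hξζ.symm⟩

theorem exists_uncountable_forall_constOrInjOn {K X : Type*} [Finite K] (g : K → I → X)
    (hJ : ¬ J.Countable) : ∃ J' ⊆ J, ¬ J'.Countable ∧ ∀ k, ConstOrInjOn (g k) J' := by
  classical
  have := Fintype.ofFinite K
  suffices hs : ∀ s : Finset K, ∃ J' ⊆ J, ¬ J'.Countable ∧ ∀ k ∈ s, ConstOrInjOn (g k) J' by
    obtain ⟨J', h1, h2, h3⟩ := hs Finset.univ
    exact ⟨J', h1, h2, fun k => h3 k (Finset.mem_univ k)⟩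
  intro s
  induction s using Finset.induction_on with
  | empty => exact ⟨J, subset_rfl, hJ, fun k hk => absurd hk (Finset.notMem_empty k)⟩
  | insert a s _ ih =>
    obtain ⟨J₁, h1, h2, h3⟩ := ih
    obtain ⟨J₂, h4, h5, h6⟩ := exists_uncountable_constOrInjOn (g a) h2
    refine ⟨J₂, h4.trans h1, h5, fun k hk => ?_⟩
    rcases Finset.mem_insert.1 hk with rfl | hk
    · exact h6
    · exact (h3 k hk).mono h4

theorem ConstOrInjOn.const_of_countable {X : Type*} [Countable X] {g : I → X}
    (h : ConstOrInjOn g J) (hJ : ¬ J.Countable) : ∃ c, ∀ ξ ∈ J, g ξ = c := by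
  refine h.resolve_right fun hi => hJ ?_
  exact Set.countable_of_injective_of_countable_image hi (Set.to_countable _)

/-- Uncountably many members of a family of finite sets are enumerated by the same finite type. -/
theorem exists_uncountable_enumeration {X : Type*} (F : I → Set X) (hF : ∀ ξ, (F ξ).Finite)
    (hJ : ¬ J.Countable) : ∃ (n : ℕ) (J' : Set I) (x : Fin n → I → X), J' ⊆ J ∧
      ¬ J'.Countable ∧ ∀ ξ ∈ J', ∀ y, y ∈ F ξ ↔ ∃ i, x i ξ = y := by
  obtain ⟨J₁, h1, h2, h3⟩ := exists_uncountable_constOrInjOn (fun ξ => (F ξ).ncard) hJ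
  obtain ⟨n, hn⟩ := h3.const_of_countable h2
  have hx : ∀ ξ : I, ∃ x : Fin n → X, ξ ∈ J₁ → ∀ y, y ∈ F ξ ↔ ∃ i, x i = y := by
    intro ξ
    by_cases hξ : ξ ∈ J₁
    · have := (hF ξ).to_subtype
      have e : Fin n ≃ F ξ := (Finite.equivFinOfCardEq (hn ξ hξ)).symm
      refine ⟨fun i => e i, fun _ y => ⟨fun hy => ⟨e.symm ⟨y, hy⟩, by simp⟩, ?_⟩⟩
      rintro ⟨i, rfl⟩
      exact (e i).2
    · obtain ⟨ζ, hζ⟩ := Set.nonempty_of_not_countable h2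
      have := (hF ζ).to_subtype
      have e : Fin n ≃ F ζ := (Finite.equivFinOfCardEq (hn ζ hζ)).symm
      exact ⟨fun i => e i, fun h => absurd h hξ⟩
  choose x hx using hx
  exact ⟨n, J₁, fun i ξ => x ξ i, h1, h2, hx⟩

end Thinning

/-! ### Products of finitely many trees -/

/-- Tuples of nodes, ordered by the reversed coordinatewise order on a finite set of
coordinates. -/
def TreeTuples {ι : Type u} (T : ι → Type v) (_ : Finset ι) : Type (max u v) := ∀ α, T α

instance {ι : Type u} (T : ι → Type v) [∀ α, PartialOrder (T α)] (e : Finset ι) :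
    Preorder (TreeTuples T e) where
  le t s := ∀ α ∈ e, s α ≤ t α
  le_refl _ _ _ := le_rfl
  le_trans _ _ _ h1 h2 α hα := (h2 α hα).trans (h1 α hα)

section TreeTuples

variable {ι : Type u} {T : ι → Type v} [∀ α, PartialOrder (T α)] [∀ α, IsSetTree (T α)]

/-- The nodes of a tuple may have different heights; raising those in `e` to the greatest of their
heights gives an element of the tree product, which is Suslin. -/
theorem IsIndependentSuslinFamily.countableChainCondition_treeTuples
    (hT : IsIndependentSuslinFamily T) (e : Finset ι) :
    CountableChainCondition (TreeTuples T e) := by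
  classical
  -- Independence says nothing about the empty product, but there any two tuples are compatible.
  rcases e.eq_empty_or_nonempty with rfl | he
  · intro A hA
    refine Set.Subsingleton.countable fun a ha b hb => ?_
    by_contra hne
    exact hA ha hb hne ⟨a, le_rfl, fun α hα => absurd hα (Finset.notMem_empty α)⟩
  have hext : ∀ t : TreeTuples T e, ∃ s : TreeProduct fun α : e => T α,
      ∀ α : e, t α ≤ s.1 α := by
    intro t
    obtain ⟨α₀, _, hα₀⟩ := e.exists_max_image (fun α => nodeHeight (t α)) he
    have h : ∀ α : e, ∃ y, t α ≤ y ∧ nodeHeight y = nodeHeight (t α₀) := fun α =>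
      (hT.1 α).exists_le_nodeHeight_eq (t α) (hα₀ α α.2)
        ((hT.1 α₀).height_eq ▸ nodeHeight_lt_treeHeight (t α₀))
    choose y hy1 hy2 using h
    exact ⟨⟨y, fun i j => (hy2 i).trans (hy2 j).symm⟩, hy1⟩
  choose g hg using hext
  refine (hT.2 e he).countableChainCondition.of_map (fun t => OrderDual.toDual (g t)) ?_
  rintro a b ⟨w, hwa, hwb⟩
  have hle : ∀ {s t : TreeProduct fun α : e => T α}, s ≤ t → ∀ i, s.1 i ≤ t.1 i := by
    rintro s t (rfl | h) i
    · exact le_rfl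
    · exact (h i).le
  let t : ∀ α, T α := fun α => if h : α ∈ e then (OrderDual.ofDual w).1 ⟨α, h⟩ else a α
  have ht : ∀ α (hα : α ∈ e), t α = (OrderDual.ofDual w).1 ⟨α, hα⟩ := fun α hα => dif_pos hα
  refine ⟨t, ?_, ?_⟩
  · intro α hα
    exact ((hg a ⟨α, hα⟩).trans (hle hwa ⟨α, hα⟩)).trans_eq (ht α hα).symm
  · intro α hα
    exact ((hg b ⟨α, hα⟩).trans (hle hwb ⟨α, hα⟩)).trans_eq (ht α hα).symm

/-- The combinatorial form of "`T b` stays Suslin after forcing with the trees in `e`". -/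
theorem IsIndependentSuslinFamily.countableChainCondition_treeTuples_prod
    (hT : IsIndependentSuslinFamily T) (e : Finset ι) {b : ι} (hb : b ∉ e) :
    CountableChainCondition (TreeTuples T e × (T b)ᵒᵈ) := by
  classical
  refine (hT.countableChainCondition_treeTuples (insert b e)).of_map
    (fun p => Function.update p.1 b (OrderDual.ofDual p.2)) ?_
  rintro ⟨a, x⟩ ⟨a', x'⟩ ⟨w, hw, hw'⟩
  have hne : ∀ α ∈ e, α ≠ b := fun α hα h => hb (h ▸ hα)
  refine ⟨(w, OrderDual.toDual (w b)), ⟨fun α hα => ?_, ?_⟩, fun α hα => ?_, ?_⟩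
  · exact (Function.update_of_ne (hne α hα) _ _).symm.trans_le
      (hw α (Finset.mem_insert_of_mem hα))
  · exact (Function.update_self b (OrderDual.ofDual x) a).symm.trans_le
      (hw b (Finset.mem_insert_self b e))
  · exact (Function.update_of_ne (hne α hα) _ _).symm.trans_le
      (hw' α (Finset.mem_insert_of_mem hα))
  · exact (Function.update_self b (OrderDual.ofDual x') a').symm.trans_le
      (hw' b (Finset.mem_insert_self b e))

/-- Nodes of trees outside `e` can be made incomparable, unless one of the families of nodes is
constant. -/
theorem IsIndependentSuslinFamily.forcingSeparable_comparable
    (hT : IsIndependentSuslinFamily T) (e : Finset ι) {I : Type*} (r : I → TreeTuples T e)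
    {J : Set I} {x y : I → Σ α, T α} (hx : ConstOrInjOn x J) (hy : ConstOrInjOn y J)
    (hx1 : ConstOrInjOn (fun ξ => (x ξ).1) J) (hy1 : ConstOrInjOn (fun ξ => (y ξ).1) J)
    (hxe : ∀ ξ ∈ J, (x ξ).1 ∉ e) :
    ForcingSeparable r J fun ξ η => x ξ ≤ y η ∨ y η ≤ x ξ →
      (∀ ζ ∈ J, x ζ = x ξ) ∨ ∀ ζ ∈ J, y ζ = y η := by
  rcases hx with ⟨c, hc⟩ | hx
  · exact ForcingSeparable.of_forall fun ξ hξ η _ _ =>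
      Or.inl fun ζ hζ => (hc ζ hζ).trans (hc ξ hξ).symm
  rcases hy with ⟨c, hc⟩ | hy
  · exact ForcingSeparable.of_forall fun ξ _ η hη _ =>
      Or.inr fun ζ hζ => (hc ζ hζ).trans (hc η hη).symm
  have hfst : ∀ {p q : Σ α, T α}, p ≤ q ∨ q ≤ p → p.1 = q.1 := by
    rintro p q (⟨i, a, b, _⟩ | ⟨i, a, b, _⟩) <;> rfl
  by_cases hb : ∃ b, (∀ ζ ∈ J, (x ζ).1 = b) ∧ ∀ ζ ∈ J, (y ζ).1 = b
  · obtain ⟨b, hxb, hyb⟩ := hb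
    have hnode : ∀ z : I → Σ α, T α, (∀ ζ ∈ J, (z ζ).1 = b) →
        ∃ z' : I → T b, ∀ ζ ∈ J, z ζ = ⟨b, z' ζ⟩ := by
      intro z hz
      have : ∀ ζ, ∃ w : T b, ζ ∈ J → z ζ = ⟨b, w⟩ := by
        intro ζ
        by_cases hζ : ζ ∈ J
        · have := hz ζ hζ
          generalize z ζ = p at this ⊢
          obtain ⟨i, a⟩ := p
          subst this
          exact ⟨a, fun _ => rfl⟩
        · obtain ⟨w⟩ := (hT.1 b).nonempty
          exact ⟨w, fun h => absurd h hζ⟩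
      exact Classical.skolem.1 this
    obtain ⟨x', hx'⟩ := hnode x hxb
    obtain ⟨y', hy'⟩ := hnode y hyb
    intro u X Y hXJ hYJ hX hY
    -- An element of `X` is needed to know that `b ∉ e`.
    rcases X.eq_empty_or_nonempty with rfl | ⟨ξ₀, hξ₀⟩
    · exact ⟨u, le_rfl, ∅, subset_rfl, Y, subset_rfl, hX, hY, fun ξ hξ => hξ.elim⟩
    have hbe : b ∉ e := hxb ξ₀ (hXJ hξ₀) ▸ hxe ξ₀ (hXJ hξ₀)
    obtain ⟨u', hu', X', hX', Y', hY', h1, h2, h3⟩ :=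
      hX.exists_incomparable (hT.1 b) (hT.countableChainCondition_treeTuples_prod e hbe) hY
        (x := x') (y := y')
        (fun ξ hξ η hη h => hx (hXJ hξ) (hXJ hη) (by
          rw [hx' ξ (hXJ hξ), hx' η (hXJ hη), h]))
        (fun ξ hξ η hη h => hy (hYJ hξ) (hYJ hη) (by
          rw [hy' ξ (hYJ hξ), hy' η (hYJ hη), h]))
    refine ⟨u', hu', X', hX', Y', hY', h1, h2, fun ξ hξ => Set.countable_empty.mono ?_⟩
    rintro η ⟨hη, hn⟩
    refine hn fun hcmp => ?_
    rw [hx' ξ (hXJ (hX' hξ)), hy' η (hYJ (hY' hη)), Sigma.mk_le_mk_iff,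
      Sigma.mk_le_mk_iff] at hcmp
    exact (hcmp.elim (h3 ξ hξ η hη).1 (h3 ξ hξ η hη).2).elim
  · exact (ForcingSeparable.eq_imp_const hx1 hy1).mono fun ξ _ η _ h hcmp =>
      absurd (h (hfst hcmp)) hb

end TreeTuples

/-! ### Compatibility in the factors -/

namespace BitForcing

variable {T : Type u} [PartialOrder T]

/-- The graph of a specializing condition. -/
def graph : (b : Fin 2) → BitForcing T b → Set (T × ℕ)
  | 0, p => {z | p.1 z.1 = some z.2}
  | 1, _ => ∅

/-- The node that a condition of the tree forcing is. -/
def node? : (b : Fin 2) → BitForcing T b → Option T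
  | 0, _ => none
  | 1, t => some (OrderDual.ofDual t)

theorem finite_graph : ∀ (b : Fin 2) (p : BitForcing T b), (graph b p).Finite
  | 0, p => by
    refine Set.Finite.of_finite_image (f := Prod.fst) (p.2.1.subset ?_) ?_
    · rintro _ ⟨⟨x, n⟩, h, rfl⟩
      change p.1 x = some n at h
      exact fun h' => Option.some_ne_none n (h.symm.trans h')
    · rintro ⟨x, n⟩ h ⟨y, m⟩ h' (rfl : x = y)
      change p.1 x = some n at h
      change p.1 x = some m at h'
      rw [Option.some.inj (h.symm.trans h')]
  | 1, _ => Set.finite_empty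

theorem eq_zero_of_mem_graph : ∀ {b : Fin 2} {p : BitForcing T b} {z : T × ℕ},
    z ∈ graph b p → b = 0
  | 0, _, _, _ => rfl
  | 1, _, _, h => h.elim

theorem eq_one_of_mem_node? : ∀ {b : Fin 2} {p : BitForcing T b} {x : T},
    x ∈ node? b p → b = 1
  | 0, _, _, h => by cases h
  | 1, _, _, _ => rfl

/-- For specializing conditions the union works: of two comparable nodes from different conditions,
one lies with its value in both, so the conflict would already occur inside `p` or `q`. The case of
equal nodes makes the union a function. -/
theorem compatible : ∀ {b : Fin 2} {p q : BitForcing T b},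
    (∀ x ∈ node? b p, ∀ y ∈ node? b q, ∃ z, x ≤ z ∧ y ≤ z) →
    (∀ x m y n, (x, m) ∈ graph b p → (y, n) ∈ graph b q → x ≤ y ∨ y ≤ x →
      (x, m) ∈ graph b q ∨ (y, n) ∈ graph b p) → ForcingCompatible p q
  | 1, p, q, h, _ => by
    obtain ⟨z, hz1, hz2⟩ := h _ rfl _ rfl
    exact ⟨OrderDual.toDual z, hz1, hz2⟩
  | 0, p, q, _, h => by
    change ∀ x m y n, p.1 x = some m → q.1 y = some n → x ≤ y ∨ y ≤ x →
      q.1 x = some m ∨ p.1 y = some n at h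
    have hz : ∀ x n, (p.1 x <|> q.1 x) = some n → p.1 x = some n ∨ q.1 x = some n := by
      intro x n hx
      cases hp : p.1 x with
      | none => rw [hp] at hx; exact Or.inr hx
      | some k => rw [hp] at hx; exact Or.inl hx
    refine ⟨⟨fun x => p.1 x <|> q.1 x, ?_, ?_⟩, ?_, ?_⟩
    · refine (p.2.1.union q.2.1).subset fun x hx => ?_
      obtain ⟨n, hn⟩ := Option.ne_none_iff_exists'.1 hx
      exact (hz x n hn).imp (fun h1 h2 => Option.some_ne_none n (h1.symm.trans h2))
        fun h1 h2 => Option.some_ne_none n (h1.symm.trans h2)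
    · intro x y m n hxy hx hy
      rcases hz x m hx with hx | hx <;> rcases hz y n hy with hy | hy
      · exact p.2.2 x y m n hxy hx hy
      · rcases h x m y n hx hy (Or.inl hxy.le) with h' | h'
        · exact q.2.2 x y m n hxy h' hy
        · exact p.2.2 x y m n hxy hx h'
      · rcases h y n x m hy hx (Or.inr hxy.le) with h' | h'
        · exact q.2.2 x y m n hxy hx h'
        · exact p.2.2 x y m n hxy h' hy
      · exact q.2.2 x y m n hxy hx hy
    · intro x n hx
      change (p.1 x <|> q.1 x) = some n
      rw [hx]
      rfl
    · intro x n hx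
      change (p.1 x <|> q.1 x) = some n
      cases hp : p.1 x with
      | none => exact hx
      | some k =>
        rcases h x k x n hp hx (Or.inl le_rfl) with h' | h'
        · exact h'.symm.trans hx
        · exact hp.symm.trans h'

end BitForcing

/-- Conditions of a finite support product are compatible if they are so on the intersection of
their supports. -/
theorem FiniteSupportProduct.compatible {ι : Type u} {P : ι → Type v} [∀ α, Preorder (P α)]
    {p q : FiniteSupportProduct P}
    (h : ∀ α (a b : P α), p.1 α = ↑a → q.1 α = ↑b → ForcingCompatible a b) :
    ForcingCompatible p q := by
  -- The last clause keeps the support of the common extension finite.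
  have hz : ∀ α, ∃ z, z ≤ p.1 α ∧ z ≤ q.1 α ∧ (p.1 α = ⊤ → q.1 α = ⊤ → z = ⊤) := by
    intro α
    cases hp : p.1 α with
    | top => exact ⟨q.1 α, le_top, le_rfl, fun _ h => h⟩
    | coe a =>
      cases hq : q.1 α with
      | top => exact ⟨↑a, le_rfl, le_top, fun h _ => h⟩
      | coe b =>
        obtain ⟨c, hc1, hc2⟩ := h α a b hp hq
        exact ⟨↑c, WithTop.coe_le_coe.2 hc1, WithTop.coe_le_coe.2 hc2,
          fun h _ => absurd h (WithTop.coe_ne_top)⟩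
  choose z hz1 hz2 hz3 using hz
  refine ⟨⟨z, (p.2.union q.2).subset fun α hα => ?_⟩, hz1, hz2⟩
  by_contra hn
  simp only [Set.mem_union, Set.mem_ofPred_eq, not_or, not_not] at hn
  exact hα (hz3 α hn.1 hn.2)

/-! ### The chain condition of the finite support product -/

theorem mainTheorem8 {ι : Type u} (T : ι → Type v) [∀ α, PartialOrder (T α)]
    [∀ α, IsSetTree (T α)] (hT : IsIndependentSuslinFamily T) (f : ι → Fin 2) :
    CountableChainCondition (FiniteSupportProduct fun α => BitForcing (T α) (f α)) := by
  classical
  intro A hA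
  by_contra hJ
  obtain ⟨m, J₁, σ, hJ₁, hJ₁c, hσ⟩ := exists_uncountable_enumeration
    (fun p : FiniteSupportProduct fun α => BitForcing (T α) (f α) => {α | p.1 α ≠ ⊤})
    (fun p => p.2) hJ
  obtain ⟨n, J₂, x, hJ₂, hJ₂c, hx⟩ := exists_uncountable_enumeration
    (fun p : FiniteSupportProduct fun α => BitForcing (T α) (f α) =>
      {z : (Σ α, T α) × ℕ | ∃ a : BitForcing (T z.1.1) (f z.1.1), p.1 z.1.1 = ↑a ∧
        (z.1.2, z.2) ∈ BitForcing.graph _ a})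
    (fun p => by
      have hfin : ∀ α, {z : (Σ α, T α) × ℕ | z.1.1 = α ∧
          ∃ a : BitForcing (T z.1.1) (f z.1.1), p.1 z.1.1 = ↑a ∧
            (z.1.2, z.2) ∈ BitForcing.graph _ a}.Finite := by
        intro α
        cases hp : p.1 α with
        | top =>
          refine Set.finite_empty.subset ?_
          rintro z ⟨rfl, a, ha, _⟩
          exact WithTop.coe_ne_top (ha.symm.trans hp)
        | coe a =>
          refine ((BitForcing.finite_graph _ a).image fun w => ((⟨α, w.1⟩ : Σ α, T α), w.2)).subset
            ?_
          rintro ⟨⟨_, t⟩, k⟩ ⟨rfl, a', ha', h⟩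
          obtain rfl : a = a' := WithTop.coe_injective (hp.symm.trans ha')
          exact ⟨(t, k), h, rfl⟩
      refine (p.2.biUnion fun α _ => hfin α).subset ?_
      rintro z ⟨a, ha, h⟩
      exact Set.mem_biUnion (x := z.1.1)
        (show p.1 z.1.1 ≠ ⊤ from ha ▸ WithTop.coe_ne_top) ⟨rfl, a, ha, h⟩) hJ₁c
  obtain ⟨J₃, hJ₃, hJ₃c, hσJ⟩ := exists_uncountable_forall_constOrInjOn σ hJ₂c
  obtain ⟨J₄, hJ₄, hJ₄c, hnode⟩ :=
    exists_uncountable_forall_constOrInjOn (fun i p => (x i p).1) hJ₃c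
  obtain ⟨J₅, hJ₅, hJ₅c, hfst⟩ :=
    exists_uncountable_forall_constOrInjOn (fun i p => (x i p).1.1) hJ₄c
  obtain ⟨J, hJ₆, hJc, hval⟩ :=
    exists_uncountable_forall_constOrInjOn (fun i p => (x i p).2) hJ₅c
  have hJA : J ⊆ A := (((((hJ₆.trans hJ₅).trans hJ₄).trans hJ₃).trans hJ₂).trans hJ₁)
  replace hσJ := fun i => (hσJ i).mono ((hJ₆.trans hJ₅).trans hJ₄)
  replace hnode := fun i => (hnode i).mono (hJ₆.trans hJ₅)
  replace hfst := fun i => (hfst i).mono hJ₆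
  replace hval := fun i => (hval i).const_of_countable hJc
  replace hσ := fun p (hp : p ∈ J) => hσ p (hJ₂ (hJ₃ (hJ₄ (hJ₅ (hJ₆ hp)))))
  replace hx := fun p (hp : p ∈ J) => hx p (hJ₃ (hJ₄ (hJ₅ (hJ₆ hp))))
  obtain ⟨p₀, hp₀⟩ := Set.nonempty_of_not_countable hJc
  -- Any `p₀ ∈ J` shows all constant coordinates. Nonconstant ones may slip in harmlessly:
  -- specialized nodes live at coordinates with `f α = 0`, hence outside `e`.
  let e : Finset ι := (Finset.univ.image fun i => σ i p₀).filter fun α => f α = 1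
  -- `r p` collects the tree nodes of `p`, with an arbitrary node wherever `p` has none.
  have hr : ∀ (p : FiniteSupportProduct fun α => BitForcing (T α) (f α)) (α : ι),
      ∃ t : T α, ∀ a : BitForcing (T α) (f α), p.1 α = ↑a → ∀ s ∈ BitForcing.node? _ a, s = t := by
    intro p α
    obtain ⟨d⟩ := (hT.1 α).nonempty
    cases hp : p.1 α with
    | top => exact ⟨d, fun a ha => absurd ha.symm WithTop.coe_ne_top⟩
    | coe a =>
      cases hn : BitForcing.node? _ a with
      | none =>
        refine ⟨d, fun a' ha' s hs => ?_⟩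
        obtain rfl := WithTop.coe_injective ha'
        rw [hn] at hs
        cases hs
      | some t =>
        refine ⟨t, fun a' ha' s hs => ?_⟩
        obtain rfl := WithTop.coe_injective ha'
        rw [hn] at hs
        exact (Option.some.inj hs).symm
  choose r hr using hr
  have hsep : ForcingSeparable (P := TreeTuples T e) r J fun p q => p ≠ q ∧
      (∀ ij : Fin m × Fin m, σ ij.1 p = σ ij.2 q →
        ∃ c, (∀ ζ ∈ J, σ ij.1 ζ = c) ∧ ∀ ζ ∈ J, σ ij.2 ζ = c) ∧
      ∀ ij : Fin n × Fin n,
        (x ij.1 p).1 ≤ (x ij.2 q).1 ∨ (x ij.2 q).1 ≤ (x ij.1 p).1 →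
          (∀ ζ ∈ J, (x ij.1 ζ).1 = (x ij.1 p).1) ∨ ∀ ζ ∈ J, (x ij.2 ζ).1 = (x ij.2 q).1 := by
    refine (ForcingSeparable.ne_of_injOn (fun p => p) (Set.injOn_id _)).and
      ((ForcingSeparable.forall_finite fun ij : Fin _ × Fin _ =>
        ForcingSeparable.eq_imp_const (hσJ ij.1) (hσJ ij.2)).and
      (ForcingSeparable.forall_finite fun ij : Fin _ × Fin _ =>
        hT.forcingSeparable_comparable e r (hnode ij.1) (hnode ij.2) (hfst ij.1) (hfst ij.2) ?_))
    intro p hp hmem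
    obtain ⟨a, _, ha⟩ := (hx p hp (x ij.1 p)).2 ⟨ij.1, rfl⟩
    have h0 := BitForcing.eq_zero_of_mem_graph ha
    rw [(Finset.mem_filter.1 hmem).2] at h0
    exact absurd h0 (by decide)
  obtain ⟨p, hp, q, hq, ⟨w, hwp, hwq⟩, hpq, hsupp, hgraph⟩ :=
    hsep.exists_compatible (hT.countableChainCondition_treeTuples e) hJc
  refine hA (hJA hp) (hJA hq) hpq (FiniteSupportProduct.compatible fun α a b ha hb => ?_)
  refine BitForcing.compatible ?_ ?_
  · intro s hs t ht
    obtain ⟨i, hi⟩ := (hσ p hp α).1 (show p.1 α ≠ ⊤ from ha ▸ WithTop.coe_ne_top)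
    obtain ⟨j, hj⟩ := (hσ q hq α).1 (show q.1 α ≠ ⊤ from hb ▸ WithTop.coe_ne_top)
    -- A coordinate in both supports is a constant entry, so it is also in the support of `p₀`.
    obtain ⟨c, hc, _⟩ := hsupp (i, j) (hi.trans hj.symm)
    have hαe : α ∈ e := by
      refine Finset.mem_filter.2 ⟨Finset.mem_image.2 ⟨i, Finset.mem_univ _, ?_⟩,
        BitForcing.eq_one_of_mem_node? hs⟩
      exact (hc p₀ hp₀).trans ((hc p hp).symm.trans hi)
    exact ⟨w α, hr p α a ha s hs ▸ hwp α hαe, hr q α b hb t ht ▸ hwq α hαe⟩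
  · intro s k t l hs ht hcmp
    obtain ⟨i, hi⟩ := (hx p hp (⟨α, s⟩, k)).1 ⟨a, ha, hs⟩
    obtain ⟨j, hj⟩ := (hx q hq (⟨α, t⟩, l)).1 ⟨b, hb, ht⟩
    have hij := hgraph (i, j)
    simp only [hi, hj, Sigma.mk_le_mk_iff] at hij
    rcases hij hcmp with h | h
    -- The node entry `i` is constant and so is its value, hence the pair is in the graph of `q`
    -- too.
    · left
      obtain ⟨c, hc⟩ := hval i
      have heq : x i q = (⟨α, s⟩, k) :=
        Prod.ext (h q hq) ((hc q hq).trans ((hc p hp).symm.trans (congrArg Prod.snd hi)))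
      obtain ⟨b', hb', hm⟩ := (hx q hq _).2 ⟨i, heq⟩
      obtain rfl : b = b' := WithTop.coe_injective (hb.symm.trans hb')
      exact hm
    · right
      obtain ⟨c, hc⟩ := hval j
      have heq : x j p = (⟨α, t⟩, l) :=
        Prod.ext (h p hp) ((hc p hp).trans ((hc q hq).symm.trans (congrArg Prod.snd hj)))
      obtain ⟨a', ha', hm⟩ := (hx p hp _).2 ⟨j, heq⟩
      obtain rfl : a = a' := WithTop.coe_injective (ha.symm.trans ha')
      exact hm
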